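/- **Theorem (the numbers of distinct squares).** Let $\sigma$ be the substitution $\sigma(a)=ab$, $\sigma(b)=ac$, $\sigma(c)=a$ on the alphabet $\{a,b,c\}$, and let $\mathbb{T}$ be the Tribonacci sequence, the fixed point of $\sigma$ beginning with $a$. Put $T_{-2}=\varepsilon$ (the empty word), $T_{-1}=c$, $T_m=\sigma^m(a)$ for $m\ge 0$, and let $t_m=|T_m|$ be the $m$-th Tribonacci number, so that $t_{-2}=0$, $t_{-1}=t_0=1$ and $t_m=t_{m-1}+t_{m-2}+t_{m-3}$ for $m\ge 1$. For $n\ge 0$ let $A(n)$ be the number of distinct squares in the prefix $\mathbb{T}[1,n]$ of length $n$ of $\mathbb{T}$, i.e. the number of nonempty words $\omega$ such that $\omega\omega$ is a factor of $\mathbb{T}[1,n]$. Put $$\alpha_m=2t_{m-1},\quad \beta_m=t_m+2t_{m-3}-1,\quad \gamma_m=2t_m-t_{m-1},\quad \theta_m=\frac{3t_m+t_{m-2}-3}{2}.$$ Then $A(n)=0$ for $n\le 7$; $A(n)=1$ for $n=8,9$; $A(n)=2$ for $10\le n\le 13$. For $n\ge 14$ there is a unique integer $m\geq -1$ with $\alpha_m\le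 n<\alpha_{m+1}$; this $m$ satisfies $m\ge 4$, and $$A(n)=\begin{cases} n-\frac12\,(t_m+t_{m-3}+m+3), & \alpha_m\le n<\beta_m;\\ \frac12\,(t_{m-1}+t_{m-2}+4t_{m-3}-m-5), & \beta_m\le n<\gamma_m;\\ n-\frac12\,(t_{m-1}+3t_{m-2}+m+3), & \gamma_m\le n<\theta_m;\\ \frac12\,(2t_{m-1}+t_{m-2}+3t_{m-3}-m-6), & \theta_m\le n<\alpha_{m+1}. \end{cases}$$ -/

import Mathlib

namespace Tribonacci

/-- The three-letter alphabet. -/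
inductive Letter where
  | a
  | b
  | c
  deriving DecidableEq

/-- The Tribonacci substitution on letters: `a ↦ ab`, `b ↦ ac`, `c ↦ a`. -/
def sigmaLetter : Letter → List Letter
  | Letter.a => [Letter.a, Letter.b]
  | Letter.b => [Letter.a, Letter.c]
  | Letter.c => [Letter.a]

/-- The Tribonacci substitution on finite words. -/
def sigma (w : List Letter) : List Letter := w.flatMap sigmaLetter

/-- The words `T_m`: `T_m = σ^m(a)` for `m ≥ 0`, `T_{-1} = c`, `T_{-2} = ε`
(and the irrelevant value `ε` for `m < -2`). -/
def T : ℤ → List Letter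
  | Int.ofNat k => sigma^[k] [Letter.a]
  | Int.negSucc 0 => [Letter.c]
  | Int.negSucc (_ + 1) => []

/-- The Tribonacci numbers `t_m = |T_m|`, so `t_{-2} = 0` and `t_{-1} = t_0 = 1`. -/
def t (m : ℤ) : ℕ := (T m).length

/-- The prefix of length `n` of an infinite sequence; letters are indexed from `0` here. -/
def pref (x : ℕ → Letter) (n : ℕ) : List Letter := (List.range n).map x

/-- `x` is a fixed point of the substitution: the image of every prefix of `x` is again a
prefix of `x`. -/
def IsFixedPoint (x : ℕ → Letter) : Prop :=
  ∀ n : ℕ, sigma (pref x n) = pref x (sigma (pref x n)).length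

/-- The Tribonacci sequence: its letter with index `i` (counted from `0`) is the letter with
index `i` of `σ^i(a)`, a word with more than `i` letters. It is the unique fixed point of the
substitution that begins with `a`: see `tribSeq_isFixedPoint` and `eq_tribSeq`. -/
def tribSeq (i : ℕ) : Letter := (sigma^[i] [Letter.a]).getD i Letter.a

/-- `A n` is the number of distinct squares in the prefix of length `n` of the Tribonacci
sequence, that is, of nonempty words `ω` such that `ωω` is a factor of this prefix. -/
noncomputable def A (n : ℕ) : ℕ :=
  Set.ncard {ω : List Letter | ω ≠ [] ∧ (ω ++ ω) <:+: pref tribSeq n}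

/-- `α_m = 2 t_{m-1}`. -/
def alpha (m : ℤ) : ℚ := 2 * t (m - 1)

/-- `β_m = t_m + 2 t_{m-3} - 1`. -/
def beta (m : ℤ) : ℚ := t m + 2 * t (m - 3) - 1

/-- `γ_m = 2 t_m - t_{m-1}`. -/
def gamma (m : ℤ) : ℚ := 2 * t m - t (m - 1)

/-- `θ_m = (3 t_m + t_{m-2} - 3) / 2`. -/
def theta (m : ℤ) : ℚ := (3 * t m + t (m - 2) - 3) / 2

theorem sigma_prefix {u v : List Letter} (h : u <+: v) : sigma u <+: sigma v := by
  obtain ⟨w, rfl⟩ := h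
  exact ⟨sigma w, by simp [sigma]⟩

theorem iter_prefix_succ (k : ℕ) : sigma^[k] [Letter.a] <+: sigma^[k + 1] [Letter.a] := by
  induction k with
  | zero => exact ⟨[Letter.b], rfl⟩
  | succ k ih =>
    rw [Function.iterate_succ_apply', Function.iterate_succ_apply' sigma (k + 1)]
    exact sigma_prefix ih

theorem iter_prefix {k l : ℕ} (h : k ≤ l) : sigma^[k] [Letter.a] <+: sigma^[l] [Letter.a] := by
  induction l, h using Nat.le_induction with
  | base => exact List.prefix_rfl
  | succ l _ ih => exact ih.trans (iter_prefix_succ l)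

theorem length_le_sigma (w : List Letter) : w.length ≤ (sigma w).length := by
  induction w with
  | nil => simp
  | cons x w ih =>
    have h : 1 ≤ (sigmaLetter x).length := by cases x <;> decide
    have e : (sigma (x :: w)).length = (sigmaLetter x).length + (sigma w).length := by
      simp [sigma]
    rw [e, List.length_cons]
    omega

theorem lt_length_iter (k : ℕ) : k < (sigma^[k] [Letter.a]).length := by
  induction k with
  | zero => simp
  | succ k ih =>
    rw [Function.iterate_succ_apply']
    obtain ⟨w, hw⟩ := iter_prefix (Nat.zero_le k)
    rw [← hw] at ih ⊢
    have e : (sigma (sigma^[0] [Letter.a] ++ w)).length = 2 + (sigma w).length := by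
      simp [sigma, sigmaLetter]
      omega
    have := length_le_sigma w
    simp at ih
    omega

theorem tribSeq_eq {l i : ℕ} (h : i < (sigma^[l] [Letter.a]).length) :
    tribSeq i = (sigma^[l] [Letter.a])[i] := by
  have hi := lt_length_iter i
  rw [tribSeq, List.getD_eq_getElem _ _ hi]
  rcases le_total i l with hl | hl
  · exact (iter_prefix hl).getElem hi
  · exact ((iter_prefix hl).getElem h).symm

theorem pref_tribSeq {l n : ℕ} (h : n ≤ (sigma^[l] [Letter.a]).length) :
    pref tribSeq n = (sigma^[l] [Letter.a]).take n := by
  apply List.ext_getElem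
  · simp [pref, h]
  · intro i h1 h2
    simp only [pref, List.getElem_map, List.getElem_range, List.getElem_take]
    apply tribSeq_eq

theorem tribSeq_zero : tribSeq 0 = Letter.a := rfl

/-- The Tribonacci sequence is a fixed point of the substitution. -/
theorem tribSeq_isFixedPoint : IsFixedPoint tribSeq := by
  intro n
  have h := pref_tribSeq (lt_length_iter n).le
  have hp : sigma (pref tribSeq n) <+: sigma^[n + 1] [Letter.a] := by
    rw [h, Function.iterate_succ_apply']
    exact sigma_prefix (List.take_prefix _ _)
  rw [pref_tribSeq hp.length_le]
  exact List.prefix_iff_eq_take.mp hp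

/-- It is the only fixed point that begins with `a`. -/
theorem eq_tribSeq (x : ℕ → Letter) (h0 : x 0 = Letter.a) (hx : IsFixedPoint x) :
    x = tribSeq := by
  have key : ∀ k : ℕ, pref x (sigma^[k] [Letter.a]).length = sigma^[k] [Letter.a] := by
    intro k
    induction k with
    | zero => simp [pref, h0]
    | succ k ih =>
      have h := hx (sigma^[k] [Letter.a]).length
      rw [ih] at h
      rw [Function.iterate_succ_apply']
      exact h.symm
  funext i
  have hi := lt_length_iter i
  rw [tribSeq_eq hi]
  have h : (pref x (sigma^[i] [Letter.a]).length)[i]? = (sigma^[i] [Letter.a])[i]? := by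
    rw [key i]
  simpa [pref, hi] using h

/-- Only finitely many squares occur in a given prefix. -/
theorem finite_squares (n : ℕ) :
    {ω : List Letter | ω ≠ [] ∧ (ω ++ ω) <:+: pref tribSeq n}.Finite := by
  refine (List.finite_toSet (pref tribSeq n).sublists).subset ?_
  rintro ω ⟨_, h⟩
  exact List.mem_sublists.mpr ((List.sublist_append_left ω ω).trans h.sublist)

end Tribonacci

namespace Tribonacci

/-! A square of period `L` at `i` is an agreement of the sequence with its shift by `L`. Every
nonempty maximal agreement is the image of a shorter one (`MaxAgree.desubstitute`), so maximal
agreements start at iterated images of letters and have length `agreeLen k` for some level `k`. Two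
adjacent letters have level-`k` images longer than `agreeLen k`. A square therefore has as period
the length of the `k`-fold image of one letter, and it lies in the run around that image
(`Agree.exists_letter`).

A first occurrence must come from the first `a`, `b` or `c`, at index 0, 1 or 3. Since the image of
`c` is a prefix of the other images, part of its run repeats squares of the `a`-run one level below.
This leaves exactly the list `NewSquareData`; `not_agree_of_lt`, which keeps occurrences of a square
a period apart, shows that every entry is new.

By `NewSquareData.period_unique`, each position ends at most one new square. In the block from `2 *
trib (M + 2)` to `2 * trib (M + 3)` these ends fill two intervals (`completesSquare_iff`). So `A`
climbs with slope one, rests, climbs and rests again; summing over blocks gives the four formulas.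
-/

/-! ### Positions of images and recognizability -/

/-- The position in the Tribonacci sequence at which the image of its letter `i` begins. -/
def imagePos (i : ℕ) : ℕ := (sigma (pref tribSeq i)).length

/-- The letter that follows the initial `a` of the image of a letter. -/
def succLetter : Letter → Letter
  | Letter.a => Letter.b
  | Letter.b => Letter.c
  | Letter.c => Letter.a

theorem succLetter_injective : Function.Injective succLetter := by
  intro x y h
  cases x <;> cases y <;> simp_all [succLetter]

theorem pref_succ (x : ℕ → Letter) (n : ℕ) : pref x (n + 1) = pref x n ++ [x n] := by
  simp [pref, List.range_succ]

theorem sigma_append (u v : List Letter) : sigma (u ++ v) = sigma u ++ sigma v := by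
  simp [sigma]

theorem sigma_pref (n : ℕ) : sigma (pref tribSeq n) = pref tribSeq (imagePos n) :=
  tribSeq_isFixedPoint n

theorem sigma_pref_succ (n : ℕ) :
    pref tribSeq (imagePos (n + 1)) = pref tribSeq (imagePos n) ++ sigmaLetter (tribSeq n) := by
  rw [← sigma_pref, ← sigma_pref, pref_succ, sigma_append]
  simp [sigma]

theorem imagePos_zero : imagePos 0 = 0 := rfl

theorem imagePos_succ (n : ℕ) :
    imagePos (n + 1) = imagePos n + (sigmaLetter (tribSeq n)).length := by
  have h := congrArg List.length (sigma_pref_succ n)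
  simpa [pref] using h

theorem tribSeq_imagePos_add {n r : ℕ} (h : r < (sigmaLetter (tribSeq n)).length) :
    tribSeq (imagePos n + r) = (sigmaLetter (tribSeq n))[r] := by
  have e := congrArg (fun l => l[imagePos n + r]?) (sigma_pref_succ n)
  have h1 : imagePos n + r < imagePos (n + 1) := by rw [imagePos_succ]; omega
  simp only [pref] at e
  rw [List.getElem?_append_right (by simp)] at e
  simpa [h1, h] using e

theorem tribSeq_imagePos (n : ℕ) : tribSeq (imagePos n) = Letter.a := by
  have h : 0 < (sigmaLetter (tribSeq n)).length := by cases tribSeq n <;> simp [sigmaLetter]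
  have := tribSeq_imagePos_add h
  rw [Nat.add_zero] at this
  rw [this]
  generalize tribSeq n = y at *
  cases y <;> rfl

/-- The image of `c` is a single `a`, but the next image supplies another `a`. So the letter after
an image's start always determines the preimage letter, without cases. -/
theorem tribSeq_imagePos_add_one (n : ℕ) :
    tribSeq (imagePos n + 1) = succLetter (tribSeq n) := by
  by_cases hc : tribSeq n = Letter.c
  · have h := imagePos_succ n
    rw [hc] at h
    change imagePos (n + 1) = imagePos n + 1 at h
    rw [← h, tribSeq_imagePos, hc]
    rfl
  · have h : 1 < (sigmaLetter (tribSeq n)).length := by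
      generalize tribSeq n = y at *
      cases y <;> simp_all [sigmaLetter]
    rw [tribSeq_imagePos_add h]
    generalize tribSeq n = y at *
    cases y <;> simp_all [sigmaLetter, succLetter]

theorem imagePos_succ_of_ne {n : ℕ} (h : tribSeq n ≠ Letter.c) :
    imagePos (n + 1) = imagePos n + 2 := by
  rw [imagePos_succ]
  generalize tribSeq n = y at *
  cases y <;> simp_all [sigmaLetter]

theorem imagePos_succ_of_eq {n : ℕ} (h : tribSeq n = Letter.c) :
    imagePos (n + 1) = imagePos n + 1 := by
  rw [imagePos_succ, h]
  rfl

theorem tribSeq_last (n : ℕ) :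
    tribSeq (imagePos (n + 1) - 1) = succLetter (tribSeq n) := by
  by_cases hc : tribSeq n = Letter.c
  · rw [imagePos_succ_of_eq hc, hc, Nat.add_sub_cancel, tribSeq_imagePos]
    rfl
  · rw [imagePos_succ_of_ne hc, ← tribSeq_imagePos_add_one]
    rfl

theorem imagePos_strictMono : StrictMono imagePos := by
  apply strictMono_nat_of_lt_succ
  intro n
  by_cases hc : tribSeq n = Letter.c
  · rw [imagePos_succ_of_eq hc]; omega
  · rw [imagePos_succ_of_ne hc]; omega

theorem lt_imagePos {n : ℕ} (h : 0 < n) : n < imagePos n := by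
  induction n, h using Nat.le_induction with
  | base => decide
  | succ n _ ih =>
    have := imagePos_strictMono (Nat.lt_succ_self n)
    simp only [Nat.succ_eq_add_one] at this
    omega

theorem exists_imagePos (p : ℕ) :
    ∃ i, p = imagePos i ∨ (p = imagePos i + 1 ∧ tribSeq i ≠ Letter.c) := by
  induction p with
  | zero => exact ⟨0, Or.inl rfl⟩
  | succ p ih =>
    obtain ⟨i, rfl | ⟨rfl, hi⟩⟩ := ih
    · by_cases hc : tribSeq i = Letter.c
      · exact ⟨i + 1, Or.inl (imagePos_succ_of_eq hc).symm⟩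
      · exact ⟨i, Or.inr ⟨rfl, hc⟩⟩
    · exact ⟨i + 1, Or.inl (imagePos_succ_of_ne hi).symm⟩

/-- Recognizability: second letters of images are only `b` or `c`, so each `a` marks a cut. -/
theorem exists_imagePos_of_eq_a {p : ℕ} (h : tribSeq p = Letter.a) : ∃ i, p = imagePos i := by
  obtain ⟨i, hi | ⟨rfl, hi⟩⟩ := exists_imagePos p
  · exact ⟨i, hi⟩
  · rw [tribSeq_imagePos_add_one] at h
    generalize tribSeq i = y at *
    cases y <;> simp_all [succLetter]

theorem eq_a_of_succ_ne {p : ℕ} (h : tribSeq (p + 1) ≠ Letter.a) : tribSeq p = Letter.a := by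
  obtain ⟨i, hi | ⟨hi, -⟩⟩ := exists_imagePos (p + 1)
  · exact absurd (hi ▸ tribSeq_imagePos i) h
  · obtain rfl : p = imagePos i := by omega
    exact tribSeq_imagePos i

/-! ### Agreements between two positions -/

/-- The factors of length `n` of the Tribonacci sequence at the positions `i` and `j` agree. -/
def Agree (i j n : ℕ) : Prop := ∀ r < n, tribSeq (i + r) = tribSeq (j + r)

theorem Agree.symm {i j n : ℕ} (h : Agree i j n) : Agree j i n := fun r hr => (h r hr).symm

theorem Agree.trans {i j k n : ℕ} (h : Agree i j n) (h' : Agree j k n) : Agree i k n :=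
  fun r hr => (h r hr).trans (h' r hr)

theorem Agree.mono {i j n m : ℕ} (h : Agree i j n) (hm : m ≤ n) : Agree i j m :=
  fun r hr => h r (by omega)

theorem Agree.shift {i j n : ℕ} (h : Agree i j n) {s m : ℕ} (hm : s + m ≤ n) :
    Agree (i + s) (j + s) m := fun r hr => by
  have := h (s + r) (by omega)
  simpa [Nat.add_assoc] using this

theorem Agree.append {i j n m : ℕ} (h : Agree i j n) (h' : Agree (i + n) (j + n) m) :
    Agree i j (n + m) := fun r hr => by
  rcases lt_or_ge r n with hn | hn
  · exact h r hn
  · have := h' (r - n) (by omega)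
    rwa [show i + n + (r - n) = i + r by omega, show j + n + (r - n) = j + r by omega] at this

theorem Agree.succ {i j n : ℕ} (h : Agree i j n) (h' : tribSeq (i + n) = tribSeq (j + n)) :
    Agree i j (n + 1) := fun r hr => by
  rcases Nat.lt_succ_iff_lt_or_eq.mp hr with hn | rfl
  · exact h r hn
  · exact h'

/-- The extra letter in `N + 1` is the initial `a` of whatever image comes next. -/
theorem Agree.image {i j n : ℕ} (h : Agree i j n) :
    ∃ N, n ≤ N ∧ imagePos (i + n) = imagePos i + N ∧ imagePos (j + n) = imagePos j + N ∧
      Agree (imagePos i) (imagePos j) (N + 1) := by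
  induction n with
  | zero =>
    refine ⟨0, le_rfl, rfl, rfl, fun r hr => ?_⟩
    obtain rfl : r = 0 := by omega
    simp [tribSeq_imagePos]
  | succ n ih =>
    obtain ⟨N, hN, h1, h2, h3⟩ := ih (h.mono (Nat.le_succ n))
    have e := h n (Nat.lt_succ_self n)
    have e1 := tribSeq_imagePos_add_one (i + n)
    have e2 := tribSeq_imagePos_add_one (j + n)
    have a1 := tribSeq_imagePos (i + n + 1)
    have a2 := tribSeq_imagePos (j + n + 1)
    by_cases hc : tribSeq (i + n) = Letter.c
    · have f1 := imagePos_succ_of_eq hc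
      have f2 := imagePos_succ_of_eq (e ▸ hc)
      rw [f1, h1] at a1
      rw [f2, h2] at a2
      exact ⟨N + 1, by omega, by rw [← Nat.add_assoc, f1, h1]; rfl,
        by rw [← Nat.add_assoc, f2, h2]; rfl, h3.succ (a1.trans a2.symm)⟩
    · have f1 := imagePos_succ_of_ne hc
      have f2 := imagePos_succ_of_ne (e ▸ hc)
      rw [f1, h1] at a1
      rw [f2, h2] at a2
      rw [h1] at e1
      rw [h2] at e2
      refine ⟨N + 2, by omega, by rw [← Nat.add_assoc, f1, h1]; rfl,
        by rw [← Nat.add_assoc, f2, h2]; rfl, (h3.succ ?_).succ (a1.trans a2.symm)⟩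
      rw [← Nat.add_assoc, ← Nat.add_assoc, e1, e2, e]

/-- The length hypothesis is generous; the only use is for agreements of every length. -/
theorem Agree.of_image {i j n : ℕ} (h : Agree (imagePos i) (imagePos j) (imagePos (i + n) + 2)) :
    Agree i j n := by
  induction n with
  | zero => intro r hr; omega
  | succ n ih =>
    have hm := imagePos_strictMono (Nat.lt_succ_self (i + n))
    have hn : Agree i j n := ih (h.mono (by
      simp only [Nat.succ_eq_add_one] at hm
      rw [← Nat.add_assoc]; omega))
    refine hn.succ (succLetter_injective ?_)
    obtain ⟨N, -, h1, h2, -⟩ := hn.image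
    rw [← tribSeq_imagePos_add_one, ← tribSeq_imagePos_add_one, h1, h2]
    refine h (N + 1) ?_
    simp only [Nat.succ_eq_add_one] at hm
    rw [← Nat.add_assoc]; omega

/-- The Tribonacci sequence is not eventually periodic. -/
theorem not_forall_agree {i j : ℕ} (hij : i < j) : ¬ ∀ n, Agree i j n := by
  induction j using Nat.strong_induction_on generalizing i with
  | _ j ih =>
  intro h
  have e : tribSeq i = tribSeq j := h 1 0 one_pos
  -- Infinite descent on `j`: at an `a` both positions desubstitute; at `b` or `c` both are preceded
  -- by `a`, so both move one step left.
  by_cases ha : tribSeq i = Letter.a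
  · obtain ⟨q, rfl⟩ := exists_imagePos_of_eq_a ha
    obtain ⟨q', rfl⟩ := exists_imagePos_of_eq_a (e ▸ ha)
    have hq := imagePos_strictMono.lt_iff_lt.mp hij
    exact ih q' (lt_imagePos (by omega)) hq fun n => Agree.of_image (h _)
  · have hi : i ≠ 0 := by rintro rfl; exact ha tribSeq_zero
    obtain ⟨i, rfl⟩ := Nat.exists_eq_succ_of_ne_zero hi
    obtain ⟨j, rfl⟩ := Nat.exists_eq_succ_of_ne_zero (show j ≠ 0 by omega)
    have e' : tribSeq i = tribSeq j :=
      (eq_a_of_succ_ne ha).trans (eq_a_of_succ_ne (e ▸ ha)).symm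
    refine ih j (Nat.lt_succ_self j) (Nat.lt_of_succ_lt_succ hij) fun n => ?_
    have h1 : Agree i j 1 := fun r hr => by
      obtain rfl : r = 0 := by omega
      exact e'
    exact (h1.append (h n)).mono (Nat.le_add_left n 1)

/-! ### Maximal agreements and desubstitution -/

/-- The factors at the positions `i` and `j` agree on exactly `n` letters, and this agreement
cannot be extended to the left. -/
structure MaxAgree (i j n : ℕ) : Prop where
  left : i = 0 ∨ tribSeq (i - 1) ≠ tribSeq (j - 1)
  agree : Agree i j n
  right : tribSeq (i + n) ≠ tribSeq (j + n)

theorem exists_agree_right {i j : ℕ} (hij : i < j) :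
    ∃ n, Agree i j n ∧ tribSeq (i + n) ≠ tribSeq (j + n) := by
  by_contra! H
  refine not_forall_agree hij fun n => ?_
  induction n with
  | zero => intro r hr; omega
  | succ n ih => exact ih.succ (H n ih)

theorem Agree.le_of_ne {i j n m : ℕ} (h : Agree i j n)
    (h' : tribSeq (i + m) ≠ tribSeq (j + m)) : n ≤ m := by
  by_contra! H
  exact h' (h m H)

/-- Every nonempty maximal agreement is the image of a shorter one. -/
theorem MaxAgree.desubstitute {i j n : ℕ} (hij : i < j) (h : MaxAgree i j n) (hn : 0 < n) :
    ∃ q q' m N, q < q' ∧ i = imagePos q ∧ j = imagePos q' ∧ MaxAgree q q' m ∧ m < n ∧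
      imagePos (q + m) = imagePos q + N ∧ n = N + 1 := by
  have e : tribSeq i = tribSeq j := h.agree 0 hn
  -- A common first letter `b` or `c` would be preceded by `a` on both sides, against left
  -- maximality.
  have ha : tribSeq i = Letter.a := by
    by_contra ha
    rcases h.left with rfl | hl
    · exact ha tribSeq_zero
    · have hi : i ≠ 0 := by rintro rfl; exact ha tribSeq_zero
      obtain ⟨i, rfl⟩ := Nat.exists_eq_succ_of_ne_zero hi
      obtain ⟨j, rfl⟩ := Nat.exists_eq_succ_of_ne_zero (show j ≠ 0 by omega)
      exact hl ((eq_a_of_succ_ne ha).trans (eq_a_of_succ_ne (e ▸ ha)).symm)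
  obtain ⟨q, rfl⟩ := exists_imagePos_of_eq_a ha
  obtain ⟨q', rfl⟩ := exists_imagePos_of_eq_a (e ▸ ha)
  have hq := imagePos_strictMono.lt_iff_lt.mp hij
  obtain ⟨m, hm, hr⟩ := exists_agree_right hq
  obtain ⟨N, hN, h1, h2, h3⟩ := hm.image
  -- Past the images and the shared `a`, the next letters reveal the first differing preimage
  -- letters.
  have hne : tribSeq (imagePos q + (N + 1)) ≠ tribSeq (imagePos q' + (N + 1)) := by
    rw [← Nat.add_assoc, ← Nat.add_assoc, ← h1, ← h2, tribSeq_imagePos_add_one,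
      tribSeq_imagePos_add_one]
    exact fun he => hr (succLetter_injective he)
  have hnN : n = N + 1 := le_antisymm (h.agree.le_of_ne hne) (h3.le_of_ne h.right)
  refine ⟨q, q', m, N, hq, rfl, rfl, ⟨?_, hm, hr⟩, by omega, h1, hnN⟩
  -- Equal preceding letters have images with equal last letters, which would extend the agreement
  -- to the left.
  by_contra! H
  obtain ⟨q, rfl⟩ := Nat.exists_eq_succ_of_ne_zero H.1
  obtain ⟨q', rfl⟩ := Nat.exists_eq_succ_of_ne_zero (show q' ≠ 0 by omega)
  have hl := h.left.resolve_left (by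
    have := lt_imagePos (Nat.succ_pos q)
    omega)
  simp only [Nat.succ_eq_add_one, tribSeq_last] at hl
  exact hl (congrArg succLetter H.2)

/-! ### Iterated images of letters and the runs around them -/

/-- The lengths of the maximal agreements. -/
def agreeLen : ℕ → ℕ
  | 0 => 0
  | k + 1 => imagePos (agreeLen k) + 1

/-- The lengths of the iterated images of the letters. -/
def imageLen : ℕ → Letter → ℕ
  | 0, _ => 1
  | k + 1, Letter.a => imageLen k Letter.a + imageLen k Letter.b
  | k + 1, Letter.b => imageLen k Letter.a + imageLen k Letter.c
  | k + 1, Letter.c => imageLen k Letter.a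

theorem imagePos_iterate_succ (k i : ℕ) :
    imagePos^[k] (i + 1) = imagePos^[k] i + imageLen k (tribSeq i) := by
  induction k generalizing i with
  | zero => rfl
  | succ k ih =>
    rw [Function.iterate_succ_apply, Function.iterate_succ_apply]
    have h1 := tribSeq_imagePos_add_one i
    rcases hx : tribSeq i with _ | _ | _
    · rw [imagePos_succ_of_ne (by simp [hx]), ih (imagePos i + 1), ih (imagePos i),
        tribSeq_imagePos, h1, hx, Nat.add_assoc]
      rfl
    · rw [imagePos_succ_of_ne (by simp [hx]), ih (imagePos i + 1), ih (imagePos i),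
        tribSeq_imagePos, h1, hx, Nat.add_assoc]
      rfl
    · rw [imagePos_succ_of_eq hx, ih (imagePos i), tribSeq_imagePos]
      rfl

theorem imagePos_iterate_zero (k : ℕ) : imagePos^[k] 0 = 0 :=
  Function.iterate_fixed imagePos_zero k

/-- Any two iterated images begin alike: each substitution maps the common prefix to its image and
adds one `a`, which is the recursion of `agreeLen`. -/
theorem agree_iterate_zero (k q : ℕ) : Agree (imagePos^[k] q) 0 (agreeLen k) := by
  induction k with
  | zero => intro r hr; simp [agreeLen] at hr
  | succ k ih =>
    obtain ⟨N, -, -, h2, h3⟩ := ih.image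
    rw [Function.iterate_succ_apply']
    rw [imagePos_zero, Nat.zero_add, Nat.zero_add] at h2
    rw [imagePos_zero] at h3
    rwa [agreeLen, h2]

theorem imagePos_iterate_add (k q : ℕ) :
    imagePos (imagePos^[k] q + agreeLen k) = imagePos^[k + 1] q + imagePos (agreeLen k) := by
  obtain ⟨N, -, h1, h2, -⟩ := (agree_iterate_zero k q).image
  rw [imagePos_zero, Nat.zero_add, Nat.zero_add] at h2
  rw [Function.iterate_succ_apply', h1, h2]

theorem agree_iterate {q q' : ℕ} (k : ℕ) (h : tribSeq q = tribSeq q') :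
    Agree (imagePos^[k] q) (imagePos^[k] q') (imageLen k (tribSeq q) + agreeLen k) := by
  refine Agree.append ?_ ?_
  · have key : ∀ k i j n, Agree i j n → ∀ M, imagePos^[k] (i + n) = imagePos^[k] i + M →
        Agree (imagePos^[k] i) (imagePos^[k] j) M := by
      intro k
      induction k with
      | zero => intro i j n h M hM; exact h.mono (by simp at hM; omega)
      | succ k ih =>
        intro i j n h M hM
        obtain ⟨N, -, h1, -, h3⟩ := h.image
        simp only [Function.iterate_succ_apply] at hM ⊢
        exact ih _ _ N (h3.mono (Nat.le_succ N)) M (by rw [← h1, hM])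
    refine key k q q' 1 (fun r hr => ?_) _ (imagePos_iterate_succ k q)
    obtain rfl : r = 0 := by omega
    exact h
  · have h1 := imagePos_iterate_succ k q'
    rw [← h] at h1
    rw [← imagePos_iterate_succ, ← h1]
    exact (agree_iterate_zero k _).trans (agree_iterate_zero k _).symm

/-- The text continues identically, for `agreeLen k` letters, from both ends of the image of a
letter; this is a run whose period is the length of that image. -/
theorem agree_iterate_run (k q : ℕ) :
    Agree (imagePos^[k] q) (imagePos^[k] q + imageLen k (tribSeq q)) (agreeLen k) := by
  rw [← imagePos_iterate_succ]
  exact (agree_iterate_zero k _).trans (agree_iterate_zero k _).symm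

theorem MaxAgree.exists_iterate {i j n : ℕ} (hij : i < j) (h : MaxAgree i j n) :
    ∃ k q q', q < q' ∧ i = imagePos^[k] q ∧ j = imagePos^[k] q' ∧ n = agreeLen k := by
  induction n using Nat.strong_induction_on generalizing i j with
  | _ n ih =>
  rcases Nat.eq_zero_or_pos n with rfl | hn
  · exact ⟨0, i, j, hij, rfl, rfl, rfl⟩
  · obtain ⟨q, q', m, N, hq, rfl, rfl, hm, hmn, h1, rfl⟩ := h.desubstitute hij hn
    obtain ⟨k, r, r', hr, rfl, rfl, rfl⟩ := ih m hmn hq hm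
    refine ⟨k + 1, r, r', hr, (Function.iterate_succ_apply' _ _ _).symm,
      (Function.iterate_succ_apply' _ _ _).symm, ?_⟩
    rw [imagePos_iterate_add, Function.iterate_succ_apply'] at h1
    rw [agreeLen]
    omega

/-! ### Arithmetic of Tribonacci numbers and agreement lengths -/

/-- The Tribonacci numbers with natural indices. -/
def trib (k : ℕ) : ℕ := imageLen k Letter.a

theorem trib_add_three (k : ℕ) : trib (k + 3) = trib (k + 2) + trib (k + 1) + trib k := by
  simp [trib, imageLen]
  omega

theorem trib_zero : trib 0 = 1 := rfl
theorem trib_one : trib 1 = 2 := rfl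
theorem trib_two : trib 2 = 4 := rfl

theorem imageLen_b (k : ℕ) : imageLen (k + 2) Letter.b = trib (k + 1) + trib k := by
  simp [trib, imageLen]

theorem imageLen_c (k : ℕ) : imageLen (k + 1) Letter.c = trib k := rfl

theorem trib_pos (k : ℕ) : 0 < trib k := by
  induction k with
  | zero => decide
  | succ k ih => simp only [trib, imageLen] at ih ⊢; omega

theorem imagePos_iterate_one (k : ℕ) : imagePos^[k] 1 = trib k := by
  have := imagePos_iterate_succ k 0
  rwa [imagePos_iterate_zero, Nat.zero_add, Nat.zero_add] at this

theorem agreeLen_succ (k : ℕ) : agreeLen (k + 1) = agreeLen k + trib k := by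
  induction k with
  | zero => rfl
  | succ k ih =>
    have h := imagePos_iterate_add k 1
    rw [imagePos_iterate_one, imagePos_iterate_one, Nat.add_comm, ← ih] at h
    have h1 : agreeLen (k + 1 + 1) = imagePos (agreeLen (k + 1)) + 1 := rfl
    have h2 : agreeLen (k + 1) = imagePos (agreeLen k) + 1 := rfl
    omega

/-- This closed form is the source of the halves in the theorem. -/
theorem two_mul_agreeLen (k : ℕ) : 2 * agreeLen k + trib k + 3 = trib (k + 2) := by
  induction k with
  | zero => rfl
  | succ k ih =>
    have h1 := agreeLen_succ k
    have h2 := trib_add_three k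
    change 2 * agreeLen (k + 1) + trib (k + 1) + 3 = trib (k + 3)
    omega

theorem trib_lt_succ (k : ℕ) : trib k < trib (k + 1) := by
  rcases k with _ | _ | k
  · decide
  · decide
  · have := trib_add_three k
    have := trib_pos (k + 1)
    change trib (k + 2) < trib (k + 3)
    omega

theorem trib_strictMono : StrictMono trib := strictMono_nat_of_lt_succ trib_lt_succ

/-- Of two adjacent letters one is `a`, and `c` has the shortest image, so this is the worst case
for a pair. -/
theorem agreeLen_lt (k : ℕ) :
    agreeLen k < imageLen k Letter.a + imageLen k Letter.c := by
  rcases k with _ | _ | _ | k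
  · decide
  · decide
  · decide
  · have h1 := two_mul_agreeLen (k + 3)
    have h2 := trib_add_three (k + 2)
    have h3 := trib_add_three (k + 1)
    have h4 := trib_add_three k
    have h5 := trib_lt_succ (k + 1)
    rw [imageLen_c]
    change _ < trib (k + 3) + _
    simp only [Nat.add_assoc, Nat.reduceAdd] at *
    omega

theorem imageLen_c_le (k : ℕ) (y : Letter) : imageLen k Letter.c ≤ imageLen k y := by
  rcases k with _ | k
  · exact le_rfl
  · cases y <;> simp [imageLen]

/-- Two adjacent letters have an iterated image longer than any agreement of that level. -/
theorem agreeLen_lt_pair (k q : ℕ) :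
    agreeLen k < imageLen k (tribSeq q) + imageLen k (tribSeq (q + 1)) := by
  have h := agreeLen_lt k
  by_cases ha : tribSeq (q + 1) = Letter.a
  · have := imageLen_c_le k (tribSeq q)
    rw [ha]
    omega
  · have := imageLen_c_le k (tribSeq (q + 1))
    rw [eq_a_of_succ_ne ha]
    omega

/-! ### Squares lie in runs around iterated images -/

/-- A repetition of exponent at least two lies in the repetition that surrounds the iterated
image of a letter. -/
theorem Agree.exists_letter {i L n : ℕ} (h : Agree i (i + L) n) (hL : 0 < L) (hn : L ≤ n) :
    ∃ k q s, i = imagePos^[k] q + s ∧ L = imageLen k (tribSeq q) ∧ s + n ≤ agreeLen k := by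
  -- The leftmost extension of the repetition with the same period makes the agreement left maximal.
  have hex : ∃ p, p ≤ i ∧ Agree p (p + L) (i - p + n) := ⟨i, le_rfl, by simpa using h⟩
  classical
  obtain ⟨hp, hpa⟩ := Nat.find_spec hex
  have hmin := fun p => @Nat.find_min _ _ hex p
  set p := Nat.find hex
  obtain ⟨l, hl, hr⟩ := exists_agree_right (show p < p + L by omega)
  have hln := hpa.le_of_ne hr
  have hmax : MaxAgree p (p + L) l := by
    refine ⟨?_, hl, hr⟩
    by_contra! H
    obtain ⟨p', hp'⟩ := Nat.exists_eq_succ_of_ne_zero H.1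
    refine hmin p' (by omega) ⟨by omega, ?_⟩
    have h1 : Agree p' (p' + L) 1 := fun r hr => by
      obtain rfl : r = 0 := by omega
      have := H.2
      rw [show p - 1 = p' by omega, show p + L - 1 = p' + L by omega] at this
      simpa using this
    refine (h1.append (m := i - p + n) ?_).mono (by omega)
    rw [show p' + 1 = p by omega, show p' + L + 1 = p + L by omega]
    exact hpa
  obtain ⟨k, q, q', hq, h1, h2, rfl⟩ := hmax.exists_iterate (by omega)
  obtain rfl | hq' : q' = q + 1 ∨ q + 2 ≤ q' := by omega
  · rw [imagePos_iterate_succ] at h2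
    exact ⟨k, q, i - p, by omega, by omega, by omega⟩
  · have h3 := (imagePos_strictMono.iterate k).monotone hq'
    have h4 := imagePos_iterate_succ k (q + 1)
    have h5 := imagePos_iterate_succ k q
    have h6 := agreeLen_lt_pair k q
    simp only [Nat.add_assoc, Nat.reduceAdd] at h4
    omega

/-! ### Squares as factors of prefixes -/

/-- The factor of length `L` of the Tribonacci sequence at the position `i`. -/
def seg (i L : ℕ) : List Letter := (List.range L).map fun r => tribSeq (i + r)

theorem length_seg (i L : ℕ) : (seg i L).length = L := by simp [seg]

theorem seg_zero (n : ℕ) : seg 0 n = pref tribSeq n := by simp [seg, pref]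

theorem seg_add (i m n : ℕ) : seg i (m + n) = seg i m ++ seg (i + m) n := by
  simp [seg, List.range_add, Nat.add_assoc]

theorem seg_eq_seg {i j L : ℕ} : seg i L = seg j L ↔ Agree i j L := by
  simp [seg, Agree, List.map_inj_left]

theorem infix_pref {w : List Letter} {n : ℕ} :
    w <:+: pref tribSeq n ↔ ∃ i, i + w.length ≤ n ∧ w = seg i w.length := by
  constructor
  · rintro ⟨u, v, h⟩
    have hl := congrArg List.length h
    simp only [List.length_append] at hl
    have hn : u.length + w.length + v.length = n := by simpa [pref] using hl
    refine ⟨u.length, by omega, ?_⟩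
    rw [← seg_zero, ← hn, seg_add, seg_add, Nat.zero_add] at h
    have h1 := (List.append_inj h (by simp [length_seg])).1
    exact (List.append_inj h1 (by simp [length_seg])).2
  · rintro ⟨i, hi, hw⟩
    refine ⟨seg 0 i, seg (i + w.length) (n - (i + w.length)), ?_⟩
    rw [← seg_zero]
    conv_lhs => enter [1, 2]; rw [hw]
    have h := seg_add 0 i w.length
    rw [Nat.zero_add] at h
    have h' := seg_add 0 (i + w.length) (n - (i + w.length))
    rw [Nat.zero_add, Nat.add_sub_cancel' hi] at h'
    rw [h', h]

theorem square_infix_pref {w : List Letter} {n : ℕ} :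
    (w ++ w) <:+: pref tribSeq n ↔
      ∃ i, i + 2 * w.length ≤ n ∧ w = seg i w.length ∧ Agree i (i + w.length) w.length := by
  rw [infix_pref]
  simp only [List.length_append, ← two_mul]
  refine exists_congr fun i => and_congr_right fun _ => ?_
  rw [two_mul, seg_add]
  constructor
  · intro h
    obtain ⟨h1, h2⟩ := List.append_inj h (by simp [length_seg])
    exact ⟨h1, seg_eq_seg.mp (h1.symm.trans h2)⟩
  · rintro ⟨h1, h2⟩
    rw [← seg_eq_seg.mpr h2, ← h1]

/-! ### Classification of the first occurrences -/

/-- A square of period `L` begins at the position `i`, and its word has no earlier occurrence. -/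
structure IsNewSquare (i L : ℕ) : Prop where
  pos : 0 < L
  agree : Agree i (i + L) L
  new : ∀ p < i, ¬ Agree p i (2 * L)

/-- The position and the period of a square, by the letter whose iterated image is conjugate to
its root. -/
inductive NewSquareData : ℕ → ℕ → Prop
  | ofA (k s : ℕ) (h : trib k + s ≤ agreeLen k) : NewSquareData s (trib k)
  | ofB (k s : ℕ) (h : s ≤ agreeLen k) :
      NewSquareData (trib (k + 2) + s) (trib (k + 1) + trib k)
  | ofC (k s : ℕ) (h : agreeLen k < trib k + s) (h' : s < trib k) :
      NewSquareData (trib (k + 2) + trib (k + 1) + s) (trib k)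

theorem tribSeq_first : tribSeq 0 = Letter.a ∧ tribSeq 1 = Letter.b ∧ tribSeq 2 = Letter.a ∧
    tribSeq 3 = Letter.c := by
  refine ⟨?_, ?_, ?_, ?_⟩ <;> decide

theorem imagePos_iterate_two (k : ℕ) : imagePos^[k] 2 = trib (k + 1) := by
  rw [← imagePos_iterate_one, Function.iterate_succ_apply]
  rfl

theorem imagePos_iterate_three (k : ℕ) : imagePos^[k] 3 = trib (k + 1) + trib k := by
  have h := imagePos_iterate_succ k 2
  rw [tribSeq_first.2.2.1, imagePos_iterate_two] at h
  exact h

/-- A square occurs again in the surroundings of every iterated image of the same letter. -/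
theorem agree_iterate_shift {q q' k s m : ℕ} (h : tribSeq q = tribSeq q')
    (hm : s + m ≤ imageLen k (tribSeq q) + agreeLen k) :
    Agree (imagePos^[k] q + s) (imagePos^[k] q' + s) m :=
  (agree_iterate k h).shift hm

/-- The whole run around an image recurs at every occurrence of the letter, so a new square belongs
to the first one. -/
theorem IsNewSquare.position_le {q q' k s L : ℕ} (hn : IsNewSquare (imagePos^[k] q + s) L)
    (h : tribSeq q = tribSeq q') (hm : s + 2 * L ≤ imageLen k (tribSeq q) + agreeLen k) :
    q ≤ q' := by
  by_contra! H
  exact hn.new _ (Nat.add_lt_add_right (imagePos_strictMono.iterate k H) s)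
    (agree_iterate_shift h.symm (by rwa [← h]))

theorem IsNewSquare.data {i L : ℕ} (hn : IsNewSquare i L) : NewSquareData i L := by
  obtain ⟨k, q, s, rfl, hL, hs⟩ := hn.agree.exists_letter hn.pos le_rfl
  obtain ⟨x0, x1, x2, x3⟩ := tribSeq_first
  have hm : s + 2 * L ≤ imageLen k (tribSeq q) + agreeLen k := by omega
  rcases hq : tribSeq q with _ | _ | _
  · have hle : q ≤ 0 := hn.position_le (hq.trans x0.symm) hm
    obtain rfl : q = 0 := by omega
    rw [hq] at hL
    rw [imagePos_iterate_zero, Nat.zero_add, hL]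
    rw [hL] at hs
    exact .ofA k s (by rw [Nat.add_comm]; exact hs)
  · have hle : q ≤ 1 := hn.position_le (hq.trans x1.symm) hm
    obtain rfl : q = 1 := by
      obtain rfl | h : q = 0 ∨ q = 1 := by omega
      · simp [x0] at hq
      · exact h
    rw [hq] at hL
    rcases k with _ | _ | k
    · simp [imageLen] at hL; simp [agreeLen] at hs; omega
    · simp [imageLen] at hL; simp [agreeLen, imagePos_zero] at hs; omega
    · rw [imagePos_iterate_one, hL, imageLen_b]
      refine .ofB k s ?_
      have h1 := agreeLen_succ k
      have h2 := agreeLen_succ (k + 1)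
      rw [imageLen_b] at hL
      simp only [Nat.add_assoc, Nat.reduceAdd] at *
      omega
  · have hle : q ≤ 3 := hn.position_le (hq.trans x3.symm) hm
    obtain rfl : q = 3 := by
      by_contra h3
      obtain rfl | rfl | rfl : q = 0 ∨ q = 1 ∨ q = 2 := by omega
      · simp [x0] at hq
      · simp [x1] at hq
      · simp [x2] at hq
    have hrun := agree_iterate_run k 3
    rw [← hL] at hrun
    rw [hq] at hL
    rcases k with _ | k
    · simp [imageLen] at hL; simp [agreeLen] at hs; omega
    rw [imageLen_c] at hL
    have hd := agreeLen_succ k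
    -- Otherwise the same square occurs one period earlier in the run.
    have hsL : s < L := by
      by_contra! H
      have := hrun.shift (s := s - L) (m := 2 * L) (by omega)
      refine hn.new _ ?_ ((by convert this using 1; omega))
      have := hn.pos
      omega
    -- Otherwise the square fits in the level-`k` run around the `a` that is the image of this `c`,
    -- hence occurs already in the run of the initial `a`.
    have hdk : agreeLen k < trib k + s := by
      by_contra! H
      have h3 : tribSeq (imagePos 3) = tribSeq 0 := (tribSeq_imagePos 3).trans x0.symm
      have := agree_iterate_shift (k := k) (s := s) (m := 2 * L) h3.symm (by
        rw [x0]
        change _ ≤ trib k + _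
        omega)
      rw [imagePos_iterate_zero, ← Function.iterate_succ_apply] at this
      refine hn.new _ ?_ this
      have := imagePos_strictMono.iterate (k + 1) (show 0 < 3 by norm_num)
      rw [imagePos_iterate_zero] at this
      omega
    rw [imagePos_iterate_three, hL]
    exact .ofC k s hdk (hL ▸ hsL)

/-- The periods of squares are the lengths of iterated images of letters. -/
theorem NewSquareData.period {i L : ℕ} (h : NewSquareData i L) :
    (∃ k, L = trib k) ∨ ∃ k, L = trib (k + 1) + trib k := by
  cases h with
  | ofA k s h => exact Or.inl ⟨k, rfl⟩
  | ofB k s h => exact Or.inr ⟨k, rfl⟩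
  | ofC k s h h' => exact Or.inl ⟨k, rfl⟩

theorem agreeLen_succ_lt (k : ℕ) : agreeLen (k + 1) < trib (k + 1) + trib k := by
  have := agreeLen_lt (k + 1)
  rwa [imageLen_c] at this

/-- Possible periods are 1, 2, 3, 4, 6, 7, 11, 13, …; the gap after a Tribonacci number is what the
`c` case of `not_agree_of_lt` needs. -/
theorem trib_add_le_of_lt {j L : ℕ} (hL : (∃ k, L = trib k) ∨ ∃ k, L = trib (k + 1) + trib k)
    (h : trib (j + 1) < L) : trib (j + 1) + trib j ≤ L := by
  obtain ⟨k, rfl⟩ | ⟨k, rfl⟩ := hL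
  · have h1 := trib_strictMono.lt_iff_lt.mp h
    obtain ⟨l, rfl⟩ : ∃ l, k = j + 2 + l := ⟨k - (j + 2), by omega⟩
    have h2 := trib_strictMono.monotone (show j + 2 ≤ j + 2 + l by omega)
    rcases j with _ | j
    · exact le_trans (by decide) h2
    · have h3 := trib_add_three j
      simp only [Nat.add_assoc, Nat.reduceAdd] at *
      omega
  · have h1 : j ≤ k := by
      by_contra! H
      have h2 := trib_strictMono.monotone (show k + 2 ≤ j + 1 by omega)
      rcases k with _ | k
      · simp only [trib_zero, trib_one, trib_two, Nat.zero_add] at *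
        omega
      · have h3 := trib_add_three k
        simp only [Nat.add_assoc, Nat.reduceAdd] at *
        omega
    exact add_le_add (trib_strictMono.monotone (by omega)) (trib_strictMono.monotone h1)

/-- Two occurrences of a square whose period is the length of an iterated image of a letter are
at least a period apart. -/
theorem not_agree_of_lt {i δ L : ℕ}
    (hL : (∃ k, L = trib k) ∨ ∃ k, L = trib (k + 1) + trib k) (h0 : 0 < δ) (hδ : δ < L) :
    ¬ Agree i (i + δ) (2 * L) := by
  intro h
  obtain ⟨k, q, s, -, hδ', hs⟩ := h.exists_letter h0 (by omega)
  rcases k with _ | k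
  · simp [agreeLen] at hs; omega
  -- A short distance `δ` would itself be the period of a run, too short to hold the `2 * L`
  -- agreeing letters.
  have hd := agreeLen_succ_lt k
  have hlt := trib_lt_succ k
  rcases hq : tribSeq q with _ | _ | _ <;> rw [hq] at hδ'
  · change δ = trib (k + 1) at hδ'
    omega
  · rcases k with _ | k
    · have h4 : agreeLen (0 + 1) = 1 := rfl
      omega
    · rw [imageLen_b] at hδ'
      have h3 := agreeLen_succ (k + 1)
      have h4 := agreeLen_succ_lt k
      simp only [Nat.add_assoc, Nat.reduceAdd] at *
      omega
  · rw [imageLen_c] at hδ'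
    have h3 := agreeLen_succ k
    rcases k with _ | k
    · have h4 : agreeLen (0 + 1) = 1 := rfl
      have h5 := trib_zero
      omega
    · have h4 := agreeLen_succ_lt k
      have h5 := trib_add_le_of_lt hL (hδ' ▸ hδ)
      omega

theorem trib_ne (j k : ℕ) : trib j ≠ trib (k + 1) + trib k := by
  intro h
  rcases lt_or_ge j (k + 2) with hj | hj
  · have := trib_strictMono.monotone (show j ≤ k + 1 by omega)
    have := trib_pos k
    omega
  · have h2 := trib_strictMono.monotone hj
    rcases k with _ | k
    · simp only [trib_zero, trib_one, trib_two, Nat.zero_add] at *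
      omega
    · have h3 := trib_add_three k
      have := trib_pos k
      simp only [Nat.add_assoc, Nat.reduceAdd] at *
      omega

theorem trib_add_strictMono : StrictMono fun k => trib (k + 1) + trib k :=
  strictMono_nat_of_lt_succ fun k => add_lt_add (trib_lt_succ (k + 1)) (trib_lt_succ k)

theorem trib_succ_le (k : ℕ) : trib (k + 1) ≤ 2 * trib k := by
  rcases k with _ | _ | k
  · decide
  · decide
  · have := trib_add_three k
    rcases k with _ | k
    · decide
    · have := trib_add_three k
      have := trib_pos k
      simp only [Nat.add_assoc, Nat.reduceAdd] at *
      omega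

theorem trib_le_agreeLen (k : ℕ) : trib k ≤ agreeLen k + 1 := by
  induction k with
  | zero => decide
  | succ k ih =>
    have := agreeLen_succ k
    have := trib_succ_le k
    omega

/-- The surroundings of an iterated image of a letter contain squares. -/
theorem agree_square {q k s L : ℕ} (hL : L = imageLen k (tribSeq q)) (hs : s + L ≤ agreeLen k) :
    Agree (imagePos^[k] q + s) (imagePos^[k] q + s + L) L := by
  have := (agree_iterate_run k q).shift hs
  rwa [← hL, Nat.add_right_comm] at this

theorem NewSquareData.agree {i L : ℕ} (h : NewSquareData i L) : Agree i (i + L) L := by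
  obtain ⟨x0, x1, x2, x3⟩ := tribSeq_first
  cases h with
  | ofA k s h =>
    have := agree_square (q := 0) (k := k) (s := i) (L := trib k) (by rw [x0]; rfl) (by omega)
    rwa [imagePos_iterate_zero, Nat.zero_add] at this
  | ofB k s h =>
    have h1 := agreeLen_succ k
    have h2 := agreeLen_succ (k + 1)
    have := agree_square (q := 1) (k := k + 2) (s := s) (L := trib (k + 1) + trib k)
      (by rw [x1, imageLen_b]) (by
        simp only [Nat.add_assoc, Nat.reduceAdd] at *
        omega)
    rwa [imagePos_iterate_one] at this
  | ofC k s h h' =>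
    have h1 := agreeLen_succ k
    have h2 := agreeLen_succ_lt k
    have h3 := trib_le_agreeLen k
    have := agree_square (q := 3) (k := k + 1) (s := s) (L := trib k)
      (by rw [x3, imageLen_c]) (by omega)
    rwa [imagePos_iterate_three] at this

/-- The earliest occurrence is itself new, hence on the list with the same period; it would lie,
directly or after transport, less than a period before `i`. -/
theorem NewSquareData.isNewSquare {i L : ℕ} (h : NewSquareData i L) : IsNewSquare i L := by
  have hpos : 0 < L := by
    obtain ⟨k, rfl⟩ | ⟨k, rfl⟩ := h.period
    · exact trib_pos k
    · exact Nat.add_pos_right _ (trib_pos k)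
  refine ⟨hpos, h.agree, fun p hp hpi => ?_⟩
  have hex : ∃ p, p < i ∧ Agree p i (2 * L) := ⟨p, hp, hpi⟩
  classical
  obtain ⟨hj, hji⟩ := Nat.find_spec hex
  have hmin := fun p => @Nat.find_min _ _ hex p
  generalize Nat.find hex = j at hj hji hmin
  have hjL : Agree j (j + L) L := by
    refine (hji.mono (by omega)).trans (h.agree.trans ?_)
    exact (hji.shift (s := L) (m := L) (by omega)).symm
  have hjn : IsNewSquare j L :=
    ⟨hpos, hjL, fun p hp hpj => hmin p hp ⟨hp.trans hj, hpj.trans hji⟩⟩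
  have near : ∀ δ, i = j + δ → ¬ δ < L := by
    rintro δ rfl hδ
    exact not_agree_of_lt h.period (by omega) hδ hji
  have hd := hjn.data
  have hne := fun k l => trib_ne k l
  cases h with
  | ofA k s h =>
    have h1 := agreeLen_lt k
    have h2 := imageLen_c_le k Letter.a
    change agreeLen k < trib k + _ at h1
    change _ ≤ trib k at h2
    exact near (i - j) (by omega) (by omega)
  | ofB k s h =>
    generalize hL' : trib (k + 1) + trib k = L' at hd
    cases hd with
    | ofA l u h1 => exact hne _ _ hL'.symm
    | ofB l u h1 =>
      obtain rfl := trib_add_strictMono.injective hL'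
      have := agreeLen_succ k
      have := agreeLen_succ_lt k
      exact near (s - u) (by omega) (by omega)
    | ofC l u h1 h2 => exact hne _ _ hL'.symm
  | ofC k s h h' =>
    generalize hL' : trib k = L' at hd
    cases hd with
    | ofA l u h1 =>
      obtain rfl := trib_strictMono.injective hL'
      obtain ⟨x0, x1, x2, x3⟩ := tribSeq_first
      have h3 : tribSeq (imagePos 3) = tribSeq 0 := (tribSeq_imagePos 3).trans x0.symm
      -- An occurrence in the initial `a`-run is copied to the `a` that is the image of the first
      -- `c`; the copy starts `s - j < trib k` letters before the square in question.
      have h4 := agree_iterate_shift (k := k) (s := j) (m := 2 * trib k) h3 (by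
        rw [tribSeq_imagePos]
        change _ ≤ trib k + _
        omega)
      rw [imagePos_iterate_zero, ← Function.iterate_succ_apply, imagePos_iterate_three,
        Nat.zero_add] at h4
      have h5 := h4.trans hji
      obtain ⟨δ, rfl⟩ : ∃ δ, s = j + δ := ⟨s - j, by omega⟩
      rw [← Nat.add_assoc] at h5
      exact not_agree_of_lt (Or.inl ⟨k, rfl⟩) (by omega) (by omega) h5
    | ofB l u h1 => exact hne _ _ hL'
    | ofC l u h1 h2 =>
      obtain rfl := trib_strictMono.injective hL'
      exact near (s - u) (by omega) (by omega)

/-! ### Where new squares end -/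

/-- A new square ends with the letter number `n`, counted from `1`. -/
def CompletesSquare (n : ℕ) : Prop := ∃ i L, NewSquareData i L ∧ n = i + 2 * L

/-- The end of a new square lies in one of two intervals, and its period is determined by the
interval. -/
theorem NewSquareData.bounds {i L : ℕ} (h : NewSquareData i L) :
    ∃ M, 2 * trib (M + 2) ≤ i + 2 * L ∧ i + 2 * L < 2 * trib (M + 3) ∧
      ((i + 2 * L ≤ trib (M + 2) + agreeLen (M + 2) ∧ L = trib (M + 2)) ∨
      (trib (M + 2) + agreeLen (M + 2) < i + 2 * L ∧ i + 2 * L < trib (M + 3) + 2 * trib M ∧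
        L = trib M) ∨
      (trib (M + 2) + 2 * trib (M + 1) + 2 * trib M ≤ i + 2 * L ∧
        i + 2 * L ≤ trib (M + 2) + 2 * trib (M + 1) + 2 * trib M + agreeLen M ∧
        L = trib (M + 1) + trib M)) := by
  cases h with
  | ofA k s h =>
    obtain ⟨M, rfl⟩ : ∃ M, k = M + 2 := by
      rcases k with _ | _ | M
      · simp [agreeLen, trib_zero] at h
      · simp [agreeLen, trib_one, imagePos_zero] at h; omega
      · exact ⟨M, rfl⟩
    have h1 := two_mul_agreeLen (M + 2)
    have h2 := trib_add_three (M + 1)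
    have h3 := trib_add_three M
    have h4 := trib_lt_succ M
    have h5 : trib (M + 2) < trib (M + 3) := trib_lt_succ _
    simp only [Nat.add_assoc, Nat.reduceAdd] at *
    exact ⟨M, by omega, by omega, by omega⟩
  | ofB k s h =>
    have g0 : trib (k + 2) ≤ 2 * trib (k + 1) := trib_succ_le _
    have h1 := two_mul_agreeLen k
    have h3 := trib_add_three k
    have h4 := trib_lt_succ k
    have h5 : trib (k + 1) < trib (k + 2) := trib_lt_succ _
    exact ⟨k, by omega, by omega, by omega⟩
  | ofC k s h h' =>
    have h1 := two_mul_agreeLen k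
    have h2 := two_mul_agreeLen (k + 2)
    have h3 := trib_add_three k
    have h6 := trib_add_three (k + 1)
    have h4 := trib_lt_succ k
    have h5 : trib (k + 1) < trib (k + 2) := trib_lt_succ _
    have h7 : trib (k + 2) < trib (k + 3) := trib_lt_succ _
    simp only [Nat.add_assoc, Nat.reduceAdd] at *
    have g0 : trib (k + 2) ≤ 2 * trib (k + 1) := trib_succ_le _
    exact ⟨k, by omega, by omega, by omega⟩

theorem block_unique {M M' n : ℕ} (h : 2 * trib (M + 2) ≤ n) (h' : n < 2 * trib (M + 3))
    (g : 2 * trib (M' + 2) ≤ n) (g' : n < 2 * trib (M' + 3)) : M = M' := by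
  have h1 := trib_strictMono.lt_iff_lt.mp (show trib (M + 2) < trib (M' + 3) by omega)
  have h2 := trib_strictMono.lt_iff_lt.mp (show trib (M' + 2) < trib (M + 3) by omega)
  omega

theorem NewSquareData.period_unique {i L i' L' : ℕ} (h : NewSquareData i L)
    (h' : NewSquareData i' L') (he : i + 2 * L = i' + 2 * L') : L = L' := by
  obtain ⟨M, h1, h2, h3⟩ := h.bounds
  obtain ⟨M', h1', h2', h3'⟩ := h'.bounds
  rw [← he] at h1' h2' h3'
  obtain rfl := block_unique h1 h2 h1' h2'
  have g0 : trib (M + 2) ≤ 2 * trib (M + 1) := trib_succ_le _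
  have h4 := two_mul_agreeLen (M + 2)
  have h5 := trib_add_three M
  have h6 := trib_add_three (M + 1)
  have h7 := trib_lt_succ M
  have h8 : trib (M + 1) < trib (M + 2) := trib_lt_succ _
  have h9 : trib (M + 2) < trib (M + 3) := trib_lt_succ _
  simp only [Nat.add_assoc, Nat.reduceAdd] at *
  omega

/-- The ends from the `a`-run of level `M + 2` (none if `M = 0`) and from the period `trib M`
squares of the first `c` abut, forming the first interval; those from the first `b` form the second.
-/
theorem completesSquare_iff {M n : ℕ} (h : 2 * trib (M + 2) ≤ n) (h' : n < 2 * trib (M + 3)) :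
    CompletesSquare n ↔ n < trib (M + 3) + 2 * trib M ∨
      (trib (M + 2) + 2 * trib (M + 1) + 2 * trib M ≤ n ∧
        n ≤ trib (M + 2) + 2 * trib (M + 1) + 2 * trib M + agreeLen M) := by
  have h5 := trib_add_three M
  have g0 : trib (M + 2) ≤ 2 * trib (M + 1) := trib_succ_le _
  have g1 := trib_succ_le M
  have g2 := trib_le_agreeLen M
  have h2 := agreeLen_succ M
  have h3 := agreeLen_succ (M + 1)
  simp only [Nat.add_assoc, Nat.reduceAdd] at h2 h3
  constructor
  · rintro ⟨i, L, hd, rfl⟩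
    obtain ⟨M', h1', h2', h3'⟩ := hd.bounds
    obtain rfl := block_unique h h' h1' h2'
    have h6 := two_mul_agreeLen M
    have h7 := trib_lt_succ M
    have h8 : trib (M + 1) < trib (M + 2) := trib_lt_succ _
    omega
  · intro hn
    rcases hn with hn | ⟨hn, hn'⟩
    · rcases le_or_gt n (trib (M + 2) + agreeLen (M + 2)) with hl | hl
      · exact ⟨_, _, .ofA (M + 2) (n - 2 * trib (M + 2)) (by omega), by omega⟩
      · exact ⟨_, _, .ofC M (n - (trib (M + 2) + trib (M + 1) + 2 * trib M)) (by omega)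
          (by omega), by omega⟩
    · exact ⟨_, _, .ofB M (n - (trib (M + 2) + 2 * trib (M + 1) + 2 * trib M)) (by omega),
        by omega⟩

theorem not_completesSquare {n : ℕ} (h : n < 8) : ¬ CompletesSquare n := by
  rintro ⟨i, L, hd, rfl⟩
  obtain ⟨M, h1, -, -⟩ := hd.bounds
  have := trib_strictMono.monotone (show 2 ≤ M + 2 by omega)
  rw [trib_two] at this
  omega

/-! ### Increments of the counting function -/

/-- The roots of the squares in the prefix of length `n`. -/
def squareRoots (n : ℕ) : Set (List Letter) :=
  {ω | ω ≠ [] ∧ (ω ++ ω) <:+: pref tribSeq n}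

theorem mem_squareRoots {w : List Letter} {n : ℕ} : w ∈ squareRoots n ↔ w ≠ [] ∧
    ∃ i, i + 2 * w.length ≤ n ∧ w = seg i w.length ∧ Agree i (i + w.length) w.length := by
  rw [squareRoots, Set.mem_ofPred_eq, square_infix_pref]

theorem seg_ne_nil {i L : ℕ} (h : 0 < L) : seg i L ≠ [] := by
  rw [← List.length_pos_iff, length_seg]
  exact h

theorem squareRoots_mono {m n : ℕ} (h : m ≤ n) : squareRoots m ⊆ squareRoots n := by
  intro w hw
  rw [mem_squareRoots] at hw ⊢
  obtain ⟨h0, i, h1, h2⟩ := hw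
  exact ⟨h0, i, h1.trans h, h2⟩

/-- A square is determined by its first half. -/
theorem Agree.double {i j L : ℕ} (h : Agree i j L) (hi : Agree i (i + L) L)
    (hj : Agree j (j + L) L) : Agree i j (2 * L) := by
  rw [two_mul]
  exact h.append (hi.symm.trans (h.trans hj))

theorem isNewSquare_of_mem {w : List Letter} {n : ℕ} (h : w ∈ squareRoots (n + 1))
    (h' : w ∉ squareRoots n) :
    ∃ i, i + 2 * w.length = n + 1 ∧ w = seg i w.length ∧ IsNewSquare i w.length := by
  rw [mem_squareRoots] at h h'
  obtain ⟨h0, i, h1, h2, h3⟩ := h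
  have hi : i + 2 * w.length = n + 1 := by
    by_contra H
    exact h' ⟨h0, i, by omega, h2, h3⟩
  refine ⟨i, hi, h2, List.length_pos_iff.mpr h0, h3, fun p hp hpi => ?_⟩
  refine h' ⟨h0, p, by omega, ?_, ?_⟩
  · rw [seg_eq_seg.mpr (hpi.mono (by omega))]
    exact h2
  · refine (hpi.mono (by omega)).trans (h3.trans (hpi.shift (by omega)).symm)

theorem A_succ_of_not {n : ℕ} (h : ¬ CompletesSquare (n + 1)) : A (n + 1) = A n := by
  have : squareRoots (n + 1) = squareRoots n := by
    refine Set.Subset.antisymm (fun w hw => ?_) (squareRoots_mono (Nat.le_succ n))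
    by_contra hw'
    obtain ⟨i, h1, -, h3⟩ := isNewSquare_of_mem hw hw'
    exact h ⟨i, w.length, h3.data, h1.symm⟩
  exact congrArg Set.ncard this

/-- The end fixes the period and hence the root, so only one square is gained. -/
theorem A_succ_of {n : ℕ} (h : CompletesSquare (n + 1)) : A (n + 1) = A n + 1 := by
  obtain ⟨i, L, hd, he⟩ := h
  have hn := hd.isNewSquare
  have hmem : seg i L ∉ squareRoots n := by
    rw [mem_squareRoots, length_seg]
    rintro ⟨-, j, h1, h2, h3⟩
    exact hn.new j (by omega) ((seg_eq_seg.mp h2).symm.double h3 hn.agree)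
  have : squareRoots (n + 1) = insert (seg i L) (squareRoots n) := by
    refine Set.Subset.antisymm (fun w hw => ?_)
      (Set.insert_subset ?_ (squareRoots_mono (Nat.le_succ n)))
    · by_cases hw' : w ∈ squareRoots n
      · exact Or.inr hw'
      · obtain ⟨j, h1, h2, h3⟩ := isNewSquare_of_mem hw hw'
        have hL := hd.period_unique h3.data (he.symm.trans h1.symm)
        obtain rfl : i = j := by omega
        rw [← hL] at h2
        exact Or.inl h2
    · rw [mem_squareRoots, length_seg]
      exact ⟨seg_ne_nil hn.pos, i, he.symm.le, rfl, hn.agree⟩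
  change (squareRoots (n + 1)).ncard = (squareRoots n).ncard + 1
  rw [this, Set.ncard_insert_of_notMem hmem (finite_squares n)]

theorem A_eq_zero {n : ℕ} (h : n < 8) : A n = 0 := by
  induction n with
  | zero =>
    have : squareRoots 0 = ∅ := by
      ext w
      simp only [mem_squareRoots, Set.mem_empty_iff_false, iff_false]
      rintro ⟨h0, i, h1, -⟩
      have := List.length_pos_iff.mpr h0
      omega
    change (squareRoots 0).ncard = 0
    rw [this, Set.ncard_empty]
  | succ n ih => rw [A_succ_of_not (not_completesSquare h), ih (by omega)]

theorem A_add {m l : ℕ} (h : ∀ n, m < n → n ≤ m + l → CompletesSquare n) :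
    A (m + l) = A m + l := by
  induction l with
  | zero => rfl
  | succ l ih =>
    rw [← Nat.add_assoc, A_succ_of (h _ (by omega) (by omega)),
      ih fun n h1 h2 => h n h1 (by omega)]
    rfl

theorem A_const {m n : ℕ} (hm : m ≤ n) (h : ∀ l, m < l → l ≤ n → ¬ CompletesSquare l) :
    A n = A m := by
  induction n, hm using Nat.le_induction with
  | base => rfl
  | succ n hn ih =>
    rw [A_succ_of_not (h _ (by omega) le_rfl), ih fun l h1 h2 => h l h1 (by omega)]

/-! ### Summation over blocks -/

/-- The values of `A` on a block, in terms of the value just before the block. -/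
theorem A_block (M : ℕ) {c : ℕ} (hc : A (2 * trib (M + 2) - 1) = c) {n : ℕ}
    (h : 2 * trib (M + 2) ≤ n + 1) (h' : n < 2 * trib (M + 3)) :
    (n < trib (M + 3) + 2 * trib M → A n + 2 * trib (M + 2) = c + n + 1) ∧
    (trib (M + 3) + 2 * trib M ≤ n + 1 → n < trib (M + 2) + 2 * trib (M + 1) + 2 * trib M →
      A n + trib (M + 2) = c + trib (M + 1) + 3 * trib M) ∧
    (trib (M + 2) + 2 * trib (M + 1) + 2 * trib M ≤ n + 1 →
      n ≤ trib (M + 2) + 2 * trib (M + 1) + 2 * trib M + agreeLen M →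
      A n + 2 * trib (M + 2) + trib (M + 1) = c + trib M + n + 1) ∧
    (trib (M + 2) + 2 * trib (M + 1) + 2 * trib M + agreeLen M ≤ n →
      A n + trib (M + 2) = c + trib (M + 1) + 3 * trib M + agreeLen M + 1) := by
  have h1 := trib_add_three M
  have h2 := two_mul_agreeLen M
  have h3 := trib_lt_succ M
  have h4 : trib (M + 1) < trib (M + 2) := trib_lt_succ _
  have h5 := trib_pos M
  -- This keeps the end of the first interval beyond the start of the block.
  have h6 : trib (M + 2) < trib (M + 1) + 3 * trib M := by
    rcases M with _ | M
    · decide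
    · have := trib_add_three M
      have := trib_lt_succ M
      simp only [Nat.add_assoc, Nat.reduceAdd] at *
      omega
  have r1 : ∀ n, 2 * trib (M + 2) ≤ n + 1 → n < trib (M + 3) + 2 * trib M →
      A n + 2 * trib (M + 2) = c + n + 1 := by
    intro n hn hn'
    have := A_add (m := 2 * trib (M + 2) - 1) (l := n + 1 - 2 * trib (M + 2)) fun l hl hl' =>
      (completesSquare_iff (M := M) (by omega) (by omega)).mpr (Or.inl (by omega))
    rw [show 2 * trib (M + 2) - 1 + (n + 1 - 2 * trib (M + 2)) = n by omega, hc] at this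
    omega
  have r2 : ∀ n, trib (M + 3) + 2 * trib M ≤ n + 1 →
      n < trib (M + 2) + 2 * trib (M + 1) + 2 * trib M →
      A n + trib (M + 2) = c + trib (M + 1) + 3 * trib M := by
    intro n hn hn'
    have := A_const (m := trib (M + 3) + 2 * trib M - 1) (n := n) (by omega) fun l hl hl' => by
      rw [completesSquare_iff (M := M) (by omega) (by omega)]
      omega
    have := r1 (trib (M + 3) + 2 * trib M - 1) (by omega) (by omega)
    omega
  have r3 : ∀ n, trib (M + 2) + 2 * trib (M + 1) + 2 * trib M ≤ n + 1 →
      n ≤ trib (M + 2) + 2 * trib (M + 1) + 2 * trib M + agreeLen M →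
      A n + 2 * trib (M + 2) + trib (M + 1) = c + trib M + n + 1 := by
    intro n hn hn'
    have := A_add (m := trib (M + 2) + 2 * trib (M + 1) + 2 * trib M - 1)
      (l := n + 1 - (trib (M + 2) + 2 * trib (M + 1) + 2 * trib M)) fun l hl hl' =>
      (completesSquare_iff (M := M) (by omega) (by omega)).mpr (Or.inr (by omega))
    rw [show trib (M + 2) + 2 * trib (M + 1) + 2 * trib M - 1 +
      (n + 1 - (trib (M + 2) + 2 * trib (M + 1) + 2 * trib M)) = n by omega] at this
    have := r2 (trib (M + 2) + 2 * trib (M + 1) + 2 * trib M - 1) (by omega) (by omega)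
    omega
  refine ⟨r1 n h, r2 n, r3 n, fun hn => ?_⟩
  have := A_const (m := trib (M + 2) + 2 * trib (M + 1) + 2 * trib M + agreeLen M) (n := n)
    (by omega) fun l hl hl' => by
      rw [completesSquare_iff (M := M) (by omega) (by omega)]
      omega
  have := r3 (trib (M + 2) + 2 * trib (M + 1) + 2 * trib M + agreeLen M) (by omega) (by omega)
  omega

/-- Twice the gain of a block is a linear form in Tribonacci numbers minus one; these ones add up to
the term `M`, hence to `m` in the theorem. -/
theorem A_before_block (M : ℕ) :
    2 * A (2 * trib (M + 2) - 1) + trib (M + 1) + 2 * trib M + M + 8 = 3 * trib (M + 2) := by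
  induction M with
  | zero =>
    rw [A_eq_zero (by decide)]
    decide
  | succ M ih =>
    have h1 := trib_add_three M
    have h2 := two_mul_agreeLen M
    have h3 := trib_lt_succ M
    have h4 : trib (M + 1) < trib (M + 2) := trib_lt_succ _
    simp only [Nat.add_assoc, Nat.reduceAdd] at *
    have := (A_block M rfl (n := 2 * trib (M + 3) - 1) (by omega) (by omega)).2.2.2 (by omega)
    omega

theorem exists_block {n : ℕ} (h : 8 ≤ n) :
    ∃ M, 2 * trib (M + 2) ≤ n ∧ n < 2 * trib (M + 3) := by
  induction n, h using Nat.le_induction with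
  | base => exact ⟨0, by decide, by decide⟩
  | succ n _ ih =>
    obtain ⟨M, h1, h2⟩ := ih
    by_cases h3 : n + 1 < 2 * trib (M + 3)
    · exact ⟨M, by omega, h3⟩
    · have := trib_lt_succ (M + 3)
      exact ⟨M + 1, by simp only [Nat.add_assoc, Nat.reduceAdd] at *; omega,
        by simp only [Nat.add_assoc, Nat.reduceAdd] at *; omega⟩

/-! ### Translation to the integer indices of the statement -/

theorem length_iterate_sigma (k : ℕ) : (sigma^[k] [Letter.a]).length = trib k := by
  have key : sigma^[k] [Letter.a] = pref tribSeq (imagePos^[k] 1) := by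
    induction k with
    | zero => rfl
    | succ k ih => rw [Function.iterate_succ_apply', ih, sigma_pref, Function.iterate_succ_apply']
  rw [key, imagePos_iterate_one]
  simp [pref]

theorem t_natCast (k : ℕ) : t (k : ℤ) = trib k := length_iterate_sigma k

theorem t_mono : Monotone t := by
  refine monotone_int_of_le_succ fun m => ?_
  match m with
  | Int.ofNat k =>
    change t ((k : ℕ) : ℤ) ≤ t ((k + 1 : ℕ) : ℤ)
    rw [t_natCast, t_natCast]
    exact (trib_lt_succ k).le
  | Int.negSucc 0 => exact le_rfl
  | Int.negSucc (k + 1) => exact Nat.zero_le _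

theorem alpha_mono : Monotone alpha := by
  intro m n h
  have : t (m - 1) ≤ t (n - 1) := t_mono (by omega)
  have : (t (m - 1) : ℚ) ≤ t (n - 1) := by exact_mod_cast this
  unfold alpha
  linarith

theorem alpha_index_unique {n m m' : ℤ} (h : alpha m ≤ n) (h' : (n : ℚ) < alpha (m + 1))
    (g : alpha m' ≤ n) (g' : (n : ℚ) < alpha (m' + 1)) : m = m' := by
  rcases lt_trichotomy m m' with hm | hm | hm
  · exact absurd (alpha_mono (show m + 1 ≤ m' by omega)) (by linarith)
  · exact hm
  · exact absurd (alpha_mono (show m' + 1 ≤ m by omega)) (by linarith)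

theorem alpha_natCast (M : ℕ) : alpha ((M : ℤ) + 3) = 2 * trib (M + 2) := by
  rw [alpha, show (M : ℤ) + 3 - 1 = ((M + 2 : ℕ) : ℤ) by push_cast; ring, t_natCast]

end Tribonacci

theorem mainTheorem1 :
    (∀ n : ℕ, n ≤ 7 → Tribonacci.A n = 0) ∧
    (∀ n : ℕ, n = 8 ∨ n = 9 → Tribonacci.A n = 1) ∧
    (∀ n : ℕ, 10 ≤ n → n ≤ 13 → Tribonacci.A n = 2) ∧
    (∀ n : ℕ, 14 ≤ n →
      (∃! m : ℤ, Tribonacci.alpha m ≤ (n : ℚ) ∧ (n : ℚ) < Tribonacci.alpha (m + 1)) ∧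
      ∀ m : ℤ, Tribonacci.alpha m ≤ (n : ℚ) → (n : ℚ) < Tribonacci.alpha (m + 1) →
        4 ≤ m ∧
        (Tribonacci.alpha m ≤ (n : ℚ) → (n : ℚ) < Tribonacci.beta m →
          (Tribonacci.A n : ℚ) =
            n - 1 / 2 * ((Tribonacci.t m : ℚ) + Tribonacci.t (m - 3) + m + 3)) ∧
        (Tribonacci.beta m ≤ (n : ℚ) → (n : ℚ) < Tribonacci.gamma m →
          (Tribonacci.A n : ℚ) =
            1 / 2 * ((Tribonacci.t (m - 1) : ℚ) + Tribonacci.t (m - 2)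
              + 4 * Tribonacci.t (m - 3) - m - 5)) ∧
        (Tribonacci.gamma m ≤ (n : ℚ) → (n : ℚ) < Tribonacci.theta m →
          (Tribonacci.A n : ℚ) =
            n - 1 / 2 * ((Tribonacci.t (m - 1) : ℚ) + 3 * Tribonacci.t (m - 2) + m + 3)) ∧
        (Tribonacci.theta m ≤ (n : ℚ) → (n : ℚ) < Tribonacci.alpha (m + 1) →
          (Tribonacci.A n : ℚ) =
            1 / 2 * (2 * (Tribonacci.t (m - 1) : ℚ) + Tribonacci.t (m - 2)
              + 3 * Tribonacci.t (m - 3) - m - 6))) := by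
  refine ⟨fun n hn => Tribonacci.A_eq_zero (by omega), ?_, ?_, ?_⟩
  · intro n hn
    have h0 := Tribonacci.A_block 0 (Tribonacci.A_eq_zero (by decide)) (n := n)
    simp only [Nat.zero_add, Tribonacci.trib_zero, Tribonacci.trib_one, Tribonacci.trib_two,
      show Tribonacci.trib 3 = 7 from rfl, show Tribonacci.agreeLen 0 = 0 from rfl] at h0
    have h1 := (h0 (by omega) (by omega)).2.1 (by omega) (by omega)
    omega
  · intro n hn hn'
    have h0 := Tribonacci.A_block 0 (Tribonacci.A_eq_zero (by decide)) (n := n)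
    simp only [Nat.zero_add, Tribonacci.trib_zero, Tribonacci.trib_one, Tribonacci.trib_two,
      show Tribonacci.trib 3 = 7 from rfl, show Tribonacci.agreeLen 0 = 0 from rfl] at h0
    have h1 := (h0 (by omega) (by omega)).2.2.2 (by omega)
    omega
  · intro n hn
    obtain ⟨M, hM, hM'⟩ := Tribonacci.exists_block (show 8 ≤ n by omega)
    have e2 := Tribonacci.alpha_natCast M
    have e3 : Tribonacci.alpha ((M : ℤ) + 3 + 1) = 2 * Tribonacci.trib (M + 3) := by
      rw [← Tribonacci.alpha_natCast (M + 1)]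
      congr 1
    have a1 : Tribonacci.alpha ((M : ℤ) + 3) ≤ (n : ℤ) := by
      rw [e2]
      exact_mod_cast hM
    have a2 : ((n : ℤ) : ℚ) < Tribonacci.alpha ((M : ℤ) + 3 + 1) := by
      rw [e3]
      exact_mod_cast hM'
    refine ⟨⟨(M : ℤ) + 3, ⟨by exact_mod_cast a1, by exact_mod_cast a2⟩, fun m hm =>
      Tribonacci.alpha_index_unique (n := n) (by exact_mod_cast hm.1) (by exact_mod_cast hm.2)
        a1 a2⟩, fun m hm hm' => ?_⟩
    obtain rfl := Tribonacci.alpha_index_unique (n := n) (by exact_mod_cast hm)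
      (by exact_mod_cast hm') a1 a2
    -- Block 0 ends at 13, so `n ≥ 14` gives `m = M + 3 ≥ 4`.
    have hM0 : 1 ≤ M := by
      by_contra! H
      obtain rfl : M = 0 := by omega
      have : Tribonacci.trib (0 + 3) = 7 := rfl
      omega
    have hA := Tribonacci.A_block M rfl (n := n) (by omega) hM'
    have hc := Tribonacci.A_before_block M
    have hd := Tribonacci.two_mul_agreeLen M
    have ht := Tribonacci.trib_add_three M
    have t0 : Tribonacci.t ((M : ℤ) + 3 - 3) = Tribonacci.trib M := by
      rw [← Tribonacci.t_natCast]
      congr 1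
      ring
    have t1 : Tribonacci.t ((M : ℤ) + 3 - 2) = Tribonacci.trib (M + 1) := by
      rw [← Tribonacci.t_natCast]
      congr 1
      push_cast
      ring
    have t2 : Tribonacci.t ((M : ℤ) + 3 - 1) = Tribonacci.trib (M + 2) := by
      rw [← Tribonacci.t_natCast]
      congr 1
      push_cast
      ring
    have t3 : Tribonacci.t ((M : ℤ) + 3) = Tribonacci.trib (M + 3) := by
      rw [← Tribonacci.t_natCast]
      congr 1
    rw [Tribonacci.beta, Tribonacci.gamma, Tribonacci.theta, t0, t1, t2, t3]
    generalize Tribonacci.A (2 * Tribonacci.trib (M + 2) - 1) = c at *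
    obtain ⟨r1, r2, r3, r4⟩ := hA
    qify at hc hd ht
    refine ⟨by omega, fun _ h => ?_, fun h h' => ?_, fun h h' => ?_, fun h h' => ?_⟩
    · have hn : n + 1 < Tribonacci.trib (M + 3) + 2 * Tribonacci.trib M := by
        qify
        linarith
      have := r1 (by omega)
      qify at this
      push_cast
      linarith
    · have hn : Tribonacci.trib (M + 3) + 2 * Tribonacci.trib M ≤ n + 1 := by
        qify
        linarith
      have hn' : n < Tribonacci.trib (M + 2) + 2 * Tribonacci.trib (M + 1)
          + 2 * Tribonacci.trib M := by
        qify
        linarith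
      have := r2 hn hn'
      qify at this
      push_cast
      linarith
    · have hn : Tribonacci.trib (M + 2) + 2 * Tribonacci.trib (M + 1)
          + 2 * Tribonacci.trib M ≤ n := by
        qify
        linarith
      have hn' : n ≤ Tribonacci.trib (M + 2) + 2 * Tribonacci.trib (M + 1)
          + 2 * Tribonacci.trib M + Tribonacci.agreeLen M := by
        qify
        linarith
      have := r3 (by omega) hn'
      qify at this
      push_cast
      linarith
    · have hn : Tribonacci.trib (M + 2) + 2 * Tribonacci.trib (M + 1)
          + 2 * Tribonacci.trib M + Tribonacci.agreeLen M ≤ n := by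
        qify
        linarith
      have := r4 hn
      qify at this
      push_cast
      linarith
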